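/- **Exact support recovery by Hard Thresholding Pursuit.** Consider the linear model $y = X\beta^* + \xi$ with $X\in\mathbb R^{n\times p}$ fixed, $n\ge 1$, $\|X_j\|_2=\sqrt n$ for every column $X_j$, and noise $\xi=(\xi_1,\dots,\xi_n)$ whose coordinates are i.i.d., of mean zero and sub-Gaussian with scale parameter $\sigma^2>0$, that is, $\mathbf E\, e^{u\xi_i}\le e^{\sigma^2u^2/2}$ for all $u\in\mathbb R$. Write $\mathrm{supp}(v)=\{i: v_i\ne0\}$, $\|v\|_0=|\mathrm{supp}(v)|$ and $S^*=\mathrm{supp}(\beta^*)$. For $s^*\ge1$ and $\lambda>0$ let $$\Omega^p_{s^*,\lambda}=\{\beta\in\mathbb R^p:\ \|\beta\|_0\le s^*,\ |\beta_i|\ge\lambda \text{ for all } i\in \mathrm{supp}(\beta)\}.$$ HTP with model size $s$ and starting value $\beta^0$ (and $S^0=\mathrm{supp}(\beta^0)$) computes, for $t=0,1,2,\dots$: a vector $\tilde\beta^{t+1}$ obtained from $\beta^t+X^\top(y-X\beta^t)/n$ by keeping $s$ coordinates that are largest in absolute value and setting the others to zero (ties broken arbitrarily); $S^{t+1}=\mathrm{supp}(\tilde\beta^{t+1})$;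 and $\beta^{t+1}$, a minimizer of $\|y-X\beta\|_2$ over all $\beta$ with $\mathrm{supp}(\beta)\subseteq S^{t+1}$. Let $C_1>0$. There is a constant $C_2>0$ depending only on $C_1$ such that for all $\varepsilon\in(0,1)$, $C_0>0$ and $\eta>0$ there is $\rho>0$ with the following property. Suppose that * $1\le s^*\le s_{\max}\le p$, $\;n\ge C_0 s_{\max}\log(p/s_{\max})$ and $s^*/p\le\rho$; * $X$ satisfies the restricted isometry property of order $3s^*$ with a constant $\delta\in(0,1)$, i.e. $(1-\delta)n\|u\|_2^2\le\|Xu\|_2^2\le(1+\delta)n\|u\|_2^2$ for all $u$ with $\|u\|_0\le 3s^*$, and $\delta<\min(\varepsilon^2,0.005)$; * $\lambda\ge(1+3\varepsilon)\sigma\{2\log(p/s^*)/n\}^{1/2}$ and $\lambda\ge(2+2\varepsilon)\sigma(2\log p/n)^{1/2}$; * $\beta^*\in\Omega^p_{s^*,\lambda}$ with $\|\beta^*\|_0=s^*$; * HTP is run with $s=s^*$ from a (possibly random) $\beta^0$ which, with probability at least $1-\eta_0$, satisfies $\|\beta^0-\beta^*\|_2\le C_1\sigma\{s^*\log(p/s^*)/n\}^{1/2}$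 and $\|\beta^0\|_0\le s^*$. Then for every $t\ge 2\log\{(C_2/\varepsilon)^2s^*\}$, $$\mathrm{pr}(S^t\ne S^*)\le\eta_0+\eta .$$ In particular, if the condition on $\beta^0$ holds almost surely ($\eta_0=0$) or with probability tending to one, then $\mathrm{pr}(S^t=S^*)\to1$ as $s^*/p\to0$, uniformly over all $\beta^*\in\Omega^p_{s^*,\lambda}$ with exactly $s^*$ nonzero coordinates. -/

import Mathlib

namespace HTP

open MeasureTheory ProbabilityTheory

/-- The Euclidean norm of a finite real vector. -/
noncomputable def l2 {ι : Type*} [Fintype ι] (v : ι → ℝ) : ℝ := ‖WithLp.toLp 2 v‖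

/-- The support of a vector. -/
noncomputable def supp {p : ℕ} (v : Fin p → ℝ) : Finset (Fin p) :=
  Finset.univ.filter fun i => v i ≠ 0

/-- Restricted isometry property of order `k` with constant `δ`: the vectors `u` with at most `k`
nonzero coordinates are exactly those carried by some index set of cardinality at most `k`. -/
def RIP {n p : ℕ} (X : Matrix (Fin n) (Fin p) ℝ) (k : ℕ) (δ : ℝ) : Prop :=
  0 < δ ∧ δ < 1 ∧ ∀ u : Fin p → ℝ, (supp u).card ≤ k →
    (1 - δ) * (n * l2 u ^ 2) ≤ l2 (X.mulVec u) ^ 2 ∧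
      l2 (X.mulVec u) ^ 2 ≤ (1 + δ) * (n * l2 u ^ 2)

/-- The noise coordinates are i.i.d., centred and sub-Gaussian with scale parameter `σ ^ 2`,
that is, `E exp (u ξᵢ) ≤ exp (σ ^ 2 * u ^ 2 / 2)` for all real `u`. -/
structure IsNoise {Ω : Type*} [MeasurableSpace Ω] (μ : Measure Ω) {n : ℕ}
    (ξ : Fin n → Ω → ℝ) (σ : ℝ) : Prop where
  indep : iIndepFun ξ μ
  ident : ∀ i j, IdentDistrib (ξ i) (ξ j) μ μ
  mean_zero : ∀ i, ∫ ω, ξ i ω ∂μ = 0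
  subgaussian : ∀ i, HasSubgaussianMGF (ξ i) (Real.toNNReal (σ ^ 2)) μ

/-- Signals with at most `s` nonzero coordinates, each of magnitude at least `lam`. -/
def signalClass (p s : ℕ) (lam : ℝ) : Set (Fin p → ℝ) :=
  {β | (supp β).card ≤ s ∧ ∀ i ∈ supp β, lam ≤ |β i|}

/-- `w` is obtained from `v` by keeping `s` coordinates that are largest in absolute value
(all of them if `s` exceeds the dimension) and setting the others to zero. Ties are broken
arbitrarily. -/
def IsHardThreshold {p : ℕ} (s : ℕ) (v w : Fin p → ℝ) : Prop :=
  ∃ A : Finset (Fin p), A.card = min s p ∧ (∀ i ∈ A, ∀ j ∉ A, |v j| ≤ |v i|) ∧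
    (∀ i ∈ A, w i = v i) ∧ ∀ i ∉ A, w i = 0

/-- The gradient descent update `b + Xᵀ (y - X b) / n`. -/
noncomputable def gradStep {n p : ℕ} (X : Matrix (Fin n) (Fin p) ℝ) (y : Fin n → ℝ)
    (b : Fin p → ℝ) : Fin p → ℝ :=
  b + (1 / (n : ℝ)) • X.transpose.mulVec (y - X.mulVec b)

/-- `b` is a least-squares estimator among the vectors carried by `S`. -/
def IsLeastSquaresOn {n p : ℕ} (X : Matrix (Fin n) (Fin p) ℝ) (y : Fin n → ℝ)
    (S : Finset (Fin p)) (b : Fin p → ℝ) : Prop :=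
  supp b ⊆ S ∧ ∀ c : Fin p → ℝ, supp c ⊆ S → l2 (y - X.mulVec b) ≤ l2 (y - X.mulVec c)

/-- `b t`, `S t` (`t = 0, 1, 2, …`) are the iterates and the selected supports of Hard Thresholding
Pursuit with model size `s` started at `b 0`. -/
structure IsRun {n p : ℕ} (X : Matrix (Fin n) (Fin p) ℝ) (y : Fin n → ℝ) (s : ℕ)
    (b : ℕ → Fin p → ℝ) (S : ℕ → Finset (Fin p)) : Prop where
  init : S 0 = supp (b 0)
  step : ∀ t, ∃ w : Fin p → ℝ, IsHardThreshold s (gradStep X y (b t)) w ∧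
    S (t + 1) = supp w ∧ IsLeastSquaresOn X y (S (t + 1)) (b (t + 1))

/-- The starting value `b₀` has at most `s` nonzero coordinates and attains the minimax rate for
sparsity `sstar` with constant `C₁`. -/
def IsMinimaxInit {p : ℕ} (n s sstar : ℕ) (σ C₁ : ℝ) (β b₀ : Fin p → ℝ) : Prop :=
  l2 (b₀ - β) ≤ C₁ * σ * Real.sqrt (sstar * Real.log (p / sstar) / n) ∧ (supp b₀).card ≤ s

end HTP

namespace HTP

open MeasureTheory ProbabilityTheory Matrix

/-! ### Euclidean norm and dot product. -/

section Euclidean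

variable {ι : Type*} [Fintype ι]

/-! All estimates compare the iterates with the oracle `β + u`, where `u` is the least-squares fit
of the noise on the true support. The update at `b` splits as `β + N + D`: `N = gradStep X ξ u` is
the oracle noise, and `D` is the deviation of the Gram matrix from the identity applied to `h = b -
β - u` (`gradStep_eq`).

`N` is linear in the noise, with sub-Gaussian coordinates, so a union bound over `p` coordinates
keeps all of them below `M`, with `2 * M` a fixed fraction below the signal level. The rest is
deterministic. By RIP `D` is small relative to `h`, so thresholding misses little of the signal
(`IsHardThreshold.l2_missed_le`); refitting costs at most about twice the missed part
(`IsLeastSquaresOn.l2_sub_oracle_le`). Thus each iteration at least halves `l2 h`. Once the missed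
part has norm below `lam`, nothing is missed. -/

theorem l2_nonneg (v : ι → ℝ) : 0 ≤ l2 v := norm_nonneg _

theorem l2_sq (v : ι → ℝ) : l2 v ^ 2 = v ⬝ᵥ v := by
  rw [l2, EuclideanSpace.norm_sq_eq]
  simp [dotProduct, sq]

theorem l2_add_le (u v : ι → ℝ) : l2 (u + v) ≤ l2 u + l2 v := by
  simpa [l2] using norm_add_le (WithLp.toLp 2 u) (WithLp.toLp 2 v)

theorem l2_sub_le (u v : ι → ℝ) : l2 (u - v) ≤ l2 u + l2 v := by
  simpa [l2] using norm_sub_le (WithLp.toLp 2 u) (WithLp.toLp 2 v)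

theorem l2_smul (c : ℝ) (u : ι → ℝ) : l2 (c • u) = |c| * l2 u := by
  simpa [l2] using norm_smul c (WithLp.toLp 2 u)

theorem eq_zero_of_l2_eq_zero {u : ι → ℝ} (h : l2 u = 0) : u = 0 := by
  simpa [l2] using h

theorem dotProduct_le_l2 (u v : ι → ℝ) : u ⬝ᵥ v ≤ l2 u * l2 v := by
  have h := real_inner_le_norm (WithLp.toLp 2 u) (WithLp.toLp 2 v)
  simpa [l2, PiLp.inner_apply, dotProduct, mul_comm] using h

theorem abs_apply_le_l2 (v : ι → ℝ) (i : ι) : |v i| ≤ l2 v := by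
  simpa [l2] using PiLp.norm_apply_le (WithLp.toLp 2 v) i

theorem l2_le_of_abs_le {u v : ι → ℝ} (h : ∀ i, |u i| ≤ |v i|) : l2 u ≤ l2 v := by
  refine le_of_sq_le_sq ?_ (l2_nonneg v)
  rw [l2_sq, l2_sq]
  refine Finset.sum_le_sum fun i _ => ?_
  rw [← sq, ← sq]
  exact sq_le_sq.2 (h i)

end Euclidean

variable {n p : ℕ}

/-! ### Supports and coordinate restriction. -/

theorem mem_supp {v : Fin p → ℝ} {i : Fin p} : i ∈ supp v ↔ v i ≠ 0 := by simp [supp]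

theorem supp_subset_iff {v : Fin p → ℝ} {S : Finset (Fin p)} :
    supp v ⊆ S ↔ ∀ i ∉ S, v i = 0 := by
  simp only [Finset.subset_iff, mem_supp]
  exact forall_congr' fun i => by tauto

/-- The vector that agrees with `v` on `S` and vanishes elsewhere. -/
noncomputable def res (S : Finset (Fin p)) (v : Fin p → ℝ) : Fin p → ℝ :=
  fun i => if i ∈ S then v i else 0

theorem supp_res_subset (S : Finset (Fin p)) (v : Fin p → ℝ) : supp (res S v) ⊆ S :=
  supp_subset_iff.2 fun i hi => by simp [res, hi]

theorem res_dotProduct (S : Finset (Fin p)) (u v : Fin p → ℝ) :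
    res S u ⬝ᵥ v = ∑ i ∈ S, u i * v i := by
  simp [res, dotProduct, ite_mul, Finset.sum_ite_mem]

theorem dotProduct_of_supp_subset {S : Finset (Fin p)} {u : Fin p → ℝ} (hu : supp u ⊆ S)
    (v : Fin p → ℝ) : u ⬝ᵥ v = ∑ i ∈ S, u i * v i := by
  rw [← res_dotProduct]
  congr 1
  ext i
  by_cases hi : i ∈ S
  · simp [res, hi]
  · simp [res, hi, supp_subset_iff.1 hu i hi]

theorem l2_res_sq (S : Finset (Fin p)) (v : Fin p → ℝ) :
    l2 (res S v) ^ 2 = ∑ i ∈ S, v i ^ 2 := by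
  rw [l2_sq, res_dotProduct]
  exact Finset.sum_congr rfl fun i hi => by simp [res, hi, sq]

theorem res_add_res_sdiff {S T : Finset (Fin p)} {v : Fin p → ℝ} (hv : supp v ⊆ S ∪ T) :
    res S v + res (T \ S) v = v := by
  ext i
  by_cases hS : i ∈ S
  · simp [res, hS]
  · by_cases hT : i ∈ T
    · simp [res, hS, hT]
    · simp [res, hS, hT, supp_subset_iff.1 hv i (by simp [hS, hT])]

theorem mulVec_dotProduct (X : Matrix (Fin n) (Fin p) ℝ) (u : Fin p → ℝ) (r : Fin n → ℝ) :
    X *ᵥ u ⬝ᵥ r = u ⬝ᵥ Xᵀ *ᵥ r := by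
  rw [dotProduct_comm, dotProduct_mulVec, ← mulVec_transpose, dotProduct_comm]

/-! ### Restricted isometry and normal equations. -/

theorem RIP.abs_sub_le {X : Matrix (Fin n) (Fin p) ℝ} {k : ℕ} {δ : ℝ} (h : RIP X k δ)
    {u : Fin p → ℝ} (hu : (supp u).card ≤ k) :
    |X *ᵥ u ⬝ᵥ X *ᵥ u - n * (u ⬝ᵥ u)| ≤ δ * n * (u ⬝ᵥ u) := by
  have h1 := h.2.2 u hu
  rw [l2_sq, l2_sq] at h1
  rw [abs_le]
  constructor <;> linarith [h1.1, h1.2]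

/-- Polarization through `u + w` and `u - w` bounds the deviation by the mean of the squared norms;
rescaling both vectors to equal norm turns the mean into the product. -/
theorem RIP.abs_bilin_le {X : Matrix (Fin n) (Fin p) ℝ} {k : ℕ} {δ : ℝ} (h : RIP X k δ)
    {T : Finset (Fin p)} (hT : T.card ≤ k) {u w : Fin p → ℝ} (hu : supp u ⊆ T)
    (hw : supp w ⊆ T) :
    |X *ᵥ u ⬝ᵥ X *ᵥ w - n * (u ⬝ᵥ w)| ≤ δ * n * (l2 u * l2 w) := by
  have key : ∀ u w : Fin p → ℝ, supp u ⊆ T → supp w ⊆ T →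
      |X *ᵥ u ⬝ᵥ X *ᵥ w - n * (u ⬝ᵥ w)| ≤ δ * n * ((l2 u ^ 2 + l2 w ^ 2) / 2) := by
    intro u w hu hw
    rw [supp_subset_iff] at hu hw
    have hadd : (supp (u + w)).card ≤ k := (Finset.card_le_card
      (supp_subset_iff.2 fun i hi => by simp [hu i hi, hw i hi])).trans hT
    have hsub : (supp (u - w)).card ≤ k := (Finset.card_le_card
      (supp_subset_iff.2 fun i hi => by simp [hu i hi, hw i hi])).trans hT
    have h1 := abs_le.1 (h.abs_sub_le hadd)
    have h2 := abs_le.1 (h.abs_sub_le hsub)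
    simp only [mulVec_add, mulVec_sub, add_dotProduct, dotProduct_add, sub_dotProduct,
      dotProduct_sub] at h1 h2
    rw [dotProduct_comm w u, dotProduct_comm (X *ᵥ w) (X *ᵥ u)] at h1 h2
    rw [l2_sq, l2_sq, abs_le]
    constructor <;> linarith [h1.1, h1.2, h2.1, h2.2]
  by_cases hu0 : l2 u = 0
  · simp [eq_zero_of_l2_eq_zero hu0, l2]
  by_cases hw0 : l2 w = 0
  · simp [eq_zero_of_l2_eq_zero hw0, l2]
  have hu1 : 0 < l2 u := (l2_nonneg u).lt_of_ne' hu0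
  have hw1 : 0 < l2 w := (l2_nonneg w).lt_of_ne' hw0
  rw [supp_subset_iff] at hu hw
  have h1 := key (l2 w • u) (l2 u • w) (supp_subset_iff.2 fun i hi => by simp [hu i hi])
    (supp_subset_iff.2 fun i hi => by simp [hw i hi])
  simp only [mulVec_smul, smul_dotProduct, dotProduct_smul, smul_eq_mul, l2_smul, abs_of_pos hu1,
    abs_of_pos hw1] at h1
  have h2 : l2 u * (l2 w * (X *ᵥ u ⬝ᵥ X *ᵥ w)) - n * (l2 u * (l2 w * (u ⬝ᵥ w))) =
      (l2 u * l2 w) * (X *ᵥ u ⬝ᵥ X *ᵥ w - n * (u ⬝ᵥ w)) := by ring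
  rw [h2, abs_mul, abs_of_pos (mul_pos hu1 hw1)] at h1
  refine le_of_mul_le_mul_left (h1.trans_eq ?_) (mul_pos hu1 hw1)
  ring

/-- The deviation of the normalized Gram matrix from the identity contracts sparse vectors. -/
theorem RIP.l2_res_sub_gram_le {X : Matrix (Fin n) (Fin p) ℝ} {k : ℕ} {δ : ℝ} (h : RIP X k δ)
    (hn : 0 < n) {T : Finset (Fin p)} (hT : T.card ≤ k) {w : Fin p → ℝ} (hw : supp w ⊆ T)
    {A : Finset (Fin p)} (hA : A ⊆ T) :
    l2 (res A (w - (1 / (n : ℝ)) • Xᵀ *ᵥ (X *ᵥ w))) ≤ δ * l2 w := by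
  have hn' : (0 : ℝ) < n := by exact_mod_cast hn
  set D := w - (1 / (n : ℝ)) • Xᵀ *ᵥ (X *ᵥ w) with hD
  have h1 := (abs_le.1 (h.abs_bilin_le hT ((supp_res_subset A D).trans hA) hw)).1
  have h2 : n * l2 (res A D) ^ 2 = -(X *ᵥ (res A D) ⬝ᵥ X *ᵥ w - n * (res A D ⬝ᵥ w)) := by
    have h3 : l2 (res A D) ^ 2 = res A D ⬝ᵥ D := by
      rw [l2_res_sq, res_dotProduct]
      simp [sq]
    rw [h3, mulVec_dotProduct]
    conv_lhs => rw [hD]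
    simp only [dotProduct_sub, dotProduct_smul, smul_eq_mul]
    field_simp
    ring
  have h4 : l2 (res A D) ^ 2 ≤ δ * l2 w * l2 (res A D) := by
    refine le_of_mul_le_mul_left ?_ hn'
    linarith
  rcases (l2_nonneg (res A D)).eq_or_lt with h5 | h5
  · rw [← h5]
    exact mul_nonneg h.1.le (l2_nonneg w)
  · rw [sq] at h4
    exact le_of_mul_le_mul_right h4 h5

theorem IsLeastSquaresOn.mulVec_dotProduct_eq_zero {X : Matrix (Fin n) (Fin p) ℝ}
    {y : Fin n → ℝ} {S : Finset (Fin p)} {b : Fin p → ℝ} (h : IsLeastSquaresOn X y S b)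
    {u : Fin p → ℝ} (hu : supp u ⊆ S) : X *ᵥ u ⬝ᵥ (y - X *ᵥ b) = 0 := by
  set q := X *ᵥ u ⬝ᵥ X *ᵥ u with hq
  set c := X *ᵥ u ⬝ᵥ (y - X *ᵥ b) with hc
  have hq0 : 0 ≤ q := by rw [hq, ← l2_sq]; positivity
  have h1 : ∀ t : ℝ, 0 ≤ -(2 * t * c) + t ^ 2 * q := by
    intro t
    have h2 := h.2 (b + t • u) (supp_subset_iff.2 fun i hi => by
      simp [supp_subset_iff.1 h.1 i hi, supp_subset_iff.1 hu i hi])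
    have h3 := pow_le_pow_left₀ (l2_nonneg _) h2 2
    have h4 : y - X *ᵥ (b + t • u) = (y - X *ᵥ b) - t • X *ᵥ u := by
      rw [mulVec_add, mulVec_smul, sub_sub]
    rw [h4, l2_sq, l2_sq] at h3
    generalize y - X *ᵥ b = r at *
    simp only [sub_dotProduct, dotProduct_sub, smul_dotProduct, dotProduct_smul, smul_eq_mul,
      dotProduct_comm r (X *ᵥ u), ← hc, ← hq] at h3
    linarith
  -- The near-optimal step length `c / (q + 1)` also covers `q = 0`.
  have h5 := h1 (c / (q + 1))
  have h6 : -(2 * (c / (q + 1)) * c) + (c / (q + 1)) ^ 2 * q = -(c ^ 2 * (q + 2) / (q + 1) ^ 2) := by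
    field_simp
    ring
  rw [h6] at h5
  by_contra h7
  have : 0 < c ^ 2 * (q + 2) / (q + 1) ^ 2 := by positivity
  linarith

/-- Solvability of the normal equations on a sparse index set. -/
theorem RIP.exists_gram_eq {X : Matrix (Fin n) (Fin p) ℝ} {k : ℕ} {δ : ℝ} (h : RIP X k δ)
    (hn : 0 < n) {S : Finset (Fin p)} (hS : S.card ≤ k) (c : Fin p → ℝ) :
    ∃ u : Fin p → ℝ, supp u ⊆ S ∧ ∀ j ∈ S, (Xᵀ *ᵥ (X *ᵥ u)) j = c j := by
  have hn' : (0 : ℝ) < n := by exact_mod_cast hn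
  let R : (Fin p → ℝ) →ₗ[ℝ] (Fin p → ℝ) :=
    { toFun := res S
      map_add' := fun u v => by ext i; by_cases hi : i ∈ S <;> simp [res, hi]
      map_smul' := fun a v => by ext i; by_cases hi : i ∈ S <;> simp [res, hi] }
  -- The Gram operator compressed to `S`, completed by the identity off `S`. It is an endomorphism
  -- of a finite-dimensional space, so the injectivity given by RIP yields surjectivity.
  let φ : (Fin p → ℝ) →ₗ[ℝ] (Fin p → ℝ) :=
    R ∘ₗ Xᵀ.mulVecLin ∘ₗ X.mulVecLin ∘ₗ R + (LinearMap.id - R)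
  have hφ : ∀ u, φ u = res S (Xᵀ *ᵥ (X *ᵥ (res S u))) + (u - res S u) := fun u => rfl
  have hon : ∀ u, ∀ j ∈ S, φ u j = (Xᵀ *ᵥ (X *ᵥ (res S u))) j := fun u j hj => by
    rw [hφ]; simp [res, hj]
  have hoff : ∀ u, ∀ j ∉ S, φ u j = u j := fun u j hj => by
    rw [hφ]; simp [res, hj]
  have hres : ∀ u, (∀ j ∉ S, u j = 0) → res S u = u := fun u hu => by
    ext i
    by_cases hi : i ∈ S
    · simp [res, hi]
    · simp [res, hi, hu i hi]
  have hinj : Function.Injective φ := by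
    rw [injective_iff_map_eq_zero]
    intro u hu
    have hu0 : ∀ j ∉ S, u j = 0 := fun j hj => by rw [← hoff u j hj, hu]; rfl
    have hsupp : supp u ⊆ S := supp_subset_iff.2 hu0
    have h1 : X *ᵥ u ⬝ᵥ X *ᵥ u = 0 := by
      rw [mulVec_dotProduct, dotProduct_of_supp_subset hsupp]
      refine Finset.sum_eq_zero fun j hj => ?_
      have h2 := hon u j hj
      rw [hres u hu0, hu] at h2
      rw [← h2]
      simp
    have h3 := (h.2.2 u ((Finset.card_le_card hsupp).trans hS)).1
    rw [l2_sq (X *ᵥ u), h1] at h3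
    have h4 : 0 < (1 - δ) * n := mul_pos (by linarith [h.2.1]) hn'
    have h5 : l2 u ^ 2 ≤ 0 := by
      by_contra h6
      push Not at h6
      nlinarith [mul_pos h4 h6]
    exact eq_zero_of_l2_eq_zero (pow_eq_zero_iff two_ne_zero |>.1 (le_antisymm h5 (sq_nonneg _)))
  obtain ⟨u, hu⟩ := LinearMap.injective_iff_surjective.1 hinj (res S c)
  refine ⟨res S u, supp_res_subset S u, fun j hj => ?_⟩
  rw [← hon u j hj, hu]
  simp [res, hj]

/-! ### Deterministic analysis of the iterations. -/

theorem gradStep_eq (X : Matrix (Fin n) (Fin p) ℝ) (β b u : Fin p → ℝ) (ξ : Fin n → ℝ) :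
    gradStep X (X *ᵥ β + ξ) b = β + gradStep X ξ u +
      ((b - β - u) - (1 / (n : ℝ)) • Xᵀ *ᵥ (X *ᵥ (b - β - u))) := by
  simp only [gradStep, mulVec_sub, mulVec_add, smul_sub, smul_add]
  abel

/-- If hard thresholding of a perturbation `β + N + D` of `β`, with `N` uniformly small, misses some
coordinates of `β`, then these are controlled by `D`. -/
theorem IsHardThreshold.exists_l2_missed_le {s : ℕ} {β N D v w : Fin p → ℝ} {M c : ℝ}
    (h : IsHardThreshold s v w) (hs : (supp β).card = s) (hv : v = β + N + D)
    (hN : ∀ i, |N i| ≤ M) (hc : 0 ≤ c) (hβ : ∀ i ∈ supp β, c * |β i| ≤ |β i| - 2 * M) :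
    ∃ A : Finset (Fin p), A.card ≤ s ∧ supp w ⊆ A ∧
      c ^ 2 * l2 (res (supp β \ supp w) β) ^ 2 ≤ 2 * l2 (res (supp β ∪ A) D) ^ 2 := by
  obtain ⟨A, hA, htop, hin, hout⟩ := h
  have hsp : s ≤ p := by rw [← hs]; exact (Finset.card_le_univ _).trans_eq (Fintype.card_fin p)
  rw [min_eq_left hsp] at hA
  refine ⟨A, hA.le, supp_subset_iff.2 hout, ?_⟩
  set B := supp β with hB
  -- As `A` and `B` both have `s` elements, each unselected true coordinate can be paired with a
  -- wrongly selected one, whose updated value is at least as large.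
  have hcard : (B \ A).card = (A \ B).card := by
    have h1 := Finset.card_sdiff_add_card_inter B A
    have h2 := Finset.card_sdiff_add_card_inter A B
    rw [Finset.inter_comm] at h2
    omega
  let e := Finset.equivOfCardEq hcard
  have hvi : ∀ i, |β i| ≤ |v i| + M + |D i| := by
    intro i
    have h1 : β i = v i - N i - D i := by rw [hv]; simp only [Pi.add_apply]; ring
    calc |β i| = |v i - N i - D i| := by rw [← h1]
      _ ≤ |v i - N i| + |D i| := abs_sub _ _
      _ ≤ |v i| + |N i| + |D i| := by gcongr; exact abs_sub _ _
      _ ≤ _ := by gcongr; exact hN i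
  have hvj : ∀ j ∉ B, |v j| ≤ M + |D j| := by
    intro j hj
    have h1 : β j = 0 := by simpa [hB, mem_supp] using hj
    have h2 : v j = N j + D j := by rw [hv]; simp [h1]
    rw [h2]
    exact (abs_add_le _ _).trans (by gcongr; exact hN j)
  have hsq : ∀ i ∈ B, ∀ a b : ℝ, c * |β i| ≤ |a| + |b| → c ^ 2 * β i ^ 2 ≤ 2 * a ^ 2 + 2 * b ^ 2 := by
    intro i _ a b hab
    have h1 : 0 ≤ c * |β i| := mul_nonneg hc (abs_nonneg _)
    have h2 := pow_le_pow_left₀ h1 hab 2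
    rw [mul_pow, sq_abs] at h2
    nlinarith [sq_nonneg (|a| - |b|), sq_abs a, sq_abs b]
  have hfar : ∀ i : ↥(B \ A), c ^ 2 * β i ^ 2 ≤ 2 * D i ^ 2 + 2 * D (e i) ^ 2 := by
    intro i
    have hi := Finset.mem_sdiff.1 i.2
    have hj := Finset.mem_sdiff.1 (e i).2
    refine hsq i hi.1 _ _ ?_
    linarith [hβ i hi.1, hvi i, hvj _ hj.2, htop _ hj.1 _ hi.2]
  -- A selected coordinate may have value zero and so drop out of `supp w`.
  have hnear : ∀ i ∈ (B \ supp w) ∩ A, c ^ 2 * β i ^ 2 ≤ 2 * D i ^ 2 := by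
    intro i hi
    simp only [Finset.mem_inter, Finset.mem_sdiff, mem_supp, not_not] at hi
    have h1 : v i = 0 := by rw [← hin i hi.2]; exact hi.1.2
    have h2 := hsq i hi.1.1 (D i) 0 (by
      have h3 := hvi i
      rw [h1] at h3
      simp only [abs_zero] at h3 ⊢
      linarith [hβ i hi.1.1, (abs_nonneg _).trans (hN i)])
    linarith
  have hsplit : B \ supp w ⊆ (B \ A) ∪ ((B \ supp w) ∩ A) := by
    intro i hi
    by_cases hiA : i ∈ A
    · simp only [Finset.mem_union, Finset.mem_inter]; exact Or.inr ⟨hi, hiA⟩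
    · exact Finset.mem_union_left _ (Finset.mem_sdiff.2 ⟨(Finset.mem_sdiff.1 hi).1, hiA⟩)
  -- `B \ A`, `A \ B` and `B ∩ A` partition `B ∪ A`, so each `D i ^ 2` is charged only once.
  have h1 : ∑ i ∈ B \ A, c ^ 2 * β i ^ 2 ≤ ∑ i ∈ B \ A, 2 * D i ^ 2 + ∑ i ∈ A \ B, 2 * D i ^ 2 := by
    rw [← Finset.sum_coe_sort (B \ A), ← Finset.sum_coe_sort (B \ A), ← Finset.sum_coe_sort (A \ B),
      ← Equiv.sum_comp e, ← Finset.sum_add_distrib]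
    exact Finset.sum_le_sum fun i _ => hfar i
  have h2 : ∑ i ∈ (B \ supp w) ∩ A, c ^ 2 * β i ^ 2 ≤ ∑ i ∈ B ∩ A, 2 * D i ^ 2 :=
    (Finset.sum_le_sum hnear).trans (Finset.sum_le_sum_of_subset_of_nonneg
      (Finset.inter_subset_inter_right Finset.sdiff_subset) fun i _ _ => by positivity)
  have h3 : ∑ i ∈ B \ supp w, c ^ 2 * β i ^ 2 ≤
      ∑ i ∈ B \ A, c ^ 2 * β i ^ 2 + ∑ i ∈ (B \ supp w) ∩ A, c ^ 2 * β i ^ 2 := by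
    rw [← Finset.sum_union]
    · exact Finset.sum_le_sum_of_subset_of_nonneg hsplit fun i _ _ => by positivity
    · rw [Finset.disjoint_left]
      intro i hi hi'
      exact (Finset.mem_sdiff.1 hi).2 (Finset.mem_inter.1 hi').2
  have h4 : ∑ i ∈ B ∪ A, 2 * D i ^ 2 =
      ∑ i ∈ B \ A, 2 * D i ^ 2 + ∑ i ∈ B ∩ A, 2 * D i ^ 2 + ∑ i ∈ A \ B, 2 * D i ^ 2 := by
    rw [← Finset.union_sdiff_self_eq_union, Finset.sum_union Finset.disjoint_sdiff,
      ← Finset.sum_inter_add_sum_sdiff B A]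
    ring
  rw [l2_res_sq, l2_res_sq, Finset.mul_sum, Finset.mul_sum]
  linarith

/-- The distance between the least-squares estimators on `S` and on the true support is controlled
by the part of the signal that `S` misses. -/
theorem IsLeastSquaresOn.l2_sub_oracle_le {X : Matrix (Fin n) (Fin p) ℝ} {s : ℕ} {δ M : ℝ}
    (hn : 0 < n) (hX : RIP X (2 * s) δ) {β u b : Fin p → ℝ} {ξ : Fin n → ℝ}
    {S : Finset (Fin p)} (hs : (supp β).card = s) (hS : S.card ≤ s)
    (hu : supp u ⊆ supp β) (hnormal : ∀ j ∈ supp β, (Xᵀ *ᵥ (ξ - X *ᵥ u)) j = 0)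
    (hM : 0 ≤ M) (hN : ∀ i, |gradStep X ξ u i| ≤ M) (hβ : ∀ i ∈ supp β, 2 * M ≤ |β i|)
    (hb : IsLeastSquaresOn X (X *ᵥ β + ξ) S b) :
    (1 - δ) * l2 (b - β - u) ≤ 2 * l2 (res (supp β \ S) β) := by
  have hn' : (0 : ℝ) < n := by exact_mod_cast hn
  set B := supp β with hB
  set h := b - β - u with hh
  set N := gradStep X ξ u with hNdef
  set m := l2 (res (B \ S) β) with hm
  have hsupp : supp h ⊆ S ∪ B := supp_subset_iff.2 fun i hi => by
    simp only [Finset.mem_union, not_or] at hi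
    have h1 : β i = 0 := by simpa [hB, mem_supp] using hi.2
    simp [hh, supp_subset_iff.1 hb.1 i hi.1, h1, supp_subset_iff.1 hu i hi.2]
  have hcardT : (S ∪ B).card ≤ 2 * s := (Finset.card_union_le _ _).trans (by omega)
  -- The gradient vanishes on `B` by the normal equations; off `B`, `u` vanishes and `N` is the
  -- gradient divided by `n`.
  have hg : ∀ i, (Xᵀ *ᵥ (ξ - X *ᵥ u)) i = n * res Bᶜ N i := by
    intro i
    by_cases hi : i ∈ B
    · simp [res, hi, hnormal i hi]
    · have h1 : u i = 0 := supp_subset_iff.1 hu i hi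
      have h2 : res Bᶜ N i = N i := by simp [res, hi]
      rw [h2, hNdef, gradStep]
      simp only [Pi.add_apply, Pi.smul_apply, smul_eq_mul, h1]
      field_simp
      ring
  -- the part of `h` on `S`
  have hon : l2 (res S h) ≤ l2 (res (S \ B) N) + δ * l2 h := by
    have h1 := hb.mulVec_dotProduct_eq_zero (supp_res_subset S h)
    have h2 : X *ᵥ β + ξ - X *ᵥ b = (ξ - X *ᵥ u) - X *ᵥ h := by
      rw [hh, mulVec_sub, mulVec_sub]; abel
    rw [h2, dotProduct_sub, mulVec_dotProduct X (res S h) (ξ - X *ᵥ u)] at h1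
    have h3 : res S h ⬝ᵥ Xᵀ *ᵥ (ξ - X *ᵥ u) = n * (res S h ⬝ᵥ res (S \ B) N) := by
      rw [res_dotProduct, res_dotProduct, Finset.mul_sum]
      refine Finset.sum_congr rfl fun i hi => ?_
      rw [hg i]
      by_cases hiB : i ∈ B <;> simp [res, hi, hiB]
      ring
    have h4 : res S h ⬝ᵥ h = l2 (res S h) ^ 2 := by
      rw [l2_res_sq, res_dotProduct]; simp [sq]
    have h5 := (abs_le.1 (hX.abs_bilin_le hcardT
      ((supp_res_subset S h).trans Finset.subset_union_left) hsupp)).1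
    have h6 := dotProduct_le_l2 (res S h) (res (S \ B) N)
    rw [h3] at h1
    rw [h4] at h5
    have h7 : l2 (res S h) ^ 2 ≤ l2 (res S h) * (l2 (res (S \ B) N) + δ * l2 h) := by
      refine le_of_mul_le_mul_left ?_ hn'
      linarith [mul_le_mul_of_nonneg_left h6 hn'.le]
    rcases (l2_nonneg (res S h)).eq_or_lt with h8 | h8
    · rw [← h8]
      have := mul_nonneg hX.1.le (l2_nonneg h)
      linarith [l2_nonneg (res (S \ B) N)]
    · rw [sq] at h7
      exact le_of_mul_le_mul_left h7 h8
  -- On `B \ S` the fit is zero, so `h = -(β + N)` with `|N| ≤ M ≤ |β| / 2`.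
  have hoff : l2 (res (B \ S) h) ≤ 3 / 2 * m := by
    have h1 : l2 ((3 / 2 : ℝ) • res (B \ S) β) = 3 / 2 * m := by
      rw [l2_smul, abs_of_pos (by norm_num)]
    rw [← h1]
    refine l2_le_of_abs_le fun i => ?_
    by_cases hi : i ∈ B \ S
    · have hi' := Finset.mem_sdiff.1 hi
      have h2 : N i = u i := by
        rw [hNdef, gradStep]
        simp [hnormal i hi'.1]
      have h3 : h i = -(β i + N i) := by
        rw [hh, h2]
        simp [supp_subset_iff.1 hb.1 i hi'.2]
        ring
      simp only [res, hi, if_true, Pi.smul_apply, smul_eq_mul, abs_mul]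
      rw [h3, abs_neg, abs_of_pos (by norm_num : (0 : ℝ) < 3 / 2)]
      linarith [abs_add_le (β i) (N i), hN i, hβ i hi'.1]
    · simp [res, hi]
  -- There are no more false inclusions than misses; each carries noise at most `M`, half of any
  -- missed signal. Together with `hoff` this gives the factor `2 = 1/2 + 3/2`.
  have hnoise : l2 (res (S \ B) N) ≤ 1 / 2 * m := by
    refine le_of_sq_le_sq ?_ (by have := l2_nonneg (res (B \ S) β); positivity)
    rw [mul_pow, hm, l2_res_sq, l2_res_sq, Finset.mul_sum]
    have hcard : (S \ B).card ≤ (B \ S).card := by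
      have h1 := Finset.card_sdiff_add_card_inter B S
      have h2 := Finset.card_sdiff_add_card_inter S B
      rw [Finset.inter_comm] at h2
      omega
    calc ∑ i ∈ S \ B, N i ^ 2 ≤ (S \ B).card • M ^ 2 :=
          Finset.sum_le_card_nsmul _ _ _ fun i _ => by
            rw [← sq_abs]; exact pow_le_pow_left₀ (abs_nonneg _) (hN i) 2
      _ ≤ (B \ S).card • M ^ 2 := by gcongr
      _ ≤ _ := Finset.card_nsmul_le_sum _ _ _ fun i hi => by
            have h1 := pow_le_pow_left₀ (by positivity) (hβ i (Finset.mem_sdiff.1 hi).1) 2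
            rw [sq_abs] at h1
            linarith
  have htri : l2 h ≤ l2 (res S h) + l2 (res (B \ S) h) := by
    conv_lhs => rw [← res_add_res_sdiff hsupp]
    exact l2_add_le _ _
  linarith

theorem RIP.mono {X : Matrix (Fin n) (Fin p) ℝ} {k l : ℕ} {δ : ℝ} (h : RIP X k δ) (hl : l ≤ k) :
    RIP X l δ :=
  ⟨h.1, h.2.1, fun u hu => h.2.2 u (hu.trans hl)⟩

theorem IsHardThreshold.card_supp_le {s : ℕ} {v w : Fin p → ℝ} (h : IsHardThreshold s v w) :
    (supp w).card ≤ s := by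
  obtain ⟨A, hA, -, -, hout⟩ := h
  exact (Finset.card_le_card (supp_subset_iff.2 hout)).trans (hA.trans_le (min_le_left _ _))

/-- One gradient and thresholding step: the missed part of the signal is controlled by the
distance of the current iterate to the oracle estimator `β + u`. -/
theorem IsHardThreshold.l2_missed_le {X : Matrix (Fin n) (Fin p) ℝ} {s : ℕ} {δ M c : ℝ}
    (hn : 0 < n) (hX : RIP X (3 * s) δ) (hδ : δ ≤ 0.16 * c) {β u b w : Fin p → ℝ} {ξ : Fin n → ℝ}
    (hs : (supp β).card = s) (hb : (supp b).card ≤ s) (hu : supp u ⊆ supp β)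
    (hN : ∀ i, |gradStep X ξ u i| ≤ M) (hβ : ∀ i ∈ supp β, c * |β i| ≤ |β i| - 2 * M)
    (hw : IsHardThreshold s (gradStep X (X *ᵥ β + ξ) b) w) :
    l2 (res (supp β \ supp w) β) ≤ 0.23 * l2 (b - β - u) := by
  have hc : 0 < c := by linarith [hX.1]
  obtain ⟨A, hA, -, hle⟩ := hw.exists_l2_missed_le hs (gradStep_eq X β b u ξ) hN hc.le hβ
  set h := b - β - u with hh
  have hsupp : supp h ⊆ supp b ∪ (supp β ∪ A) := supp_subset_iff.2 fun i hi => by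
    simp only [Finset.mem_union, not_or] at hi
    have h1 : b i = 0 := by simpa [mem_supp] using hi.1
    have h2 : β i = 0 := by simpa [mem_supp] using hi.2.1
    simp [hh, h1, h2, supp_subset_iff.1 hu i hi.2.1]
  -- Three supports are involved, whence RIP of order `3 * s`.
  have hcard : (supp b ∪ (supp β ∪ A)).card ≤ 3 * s := by
    have h1 := Finset.card_union_le (supp b) (supp β ∪ A)
    have h2 := Finset.card_union_le (supp β) A
    omega
  have hD := hX.l2_res_sub_gram_le hn hcard hsupp
    (Finset.subset_union_right : supp β ∪ A ⊆ supp b ∪ (supp β ∪ A))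
  have hH := l2_nonneg h
  have h1 : l2 (res (supp β ∪ A) (h - (1 / (n : ℝ)) • Xᵀ *ᵥ (X *ᵥ h))) ≤ c * (0.16 * l2 h) :=
    hD.trans (by nlinarith)
  have h2 := pow_le_pow_left₀ (l2_nonneg _) h1 2
  rw [mul_pow] at h2
  have h3 : l2 (res (supp β \ supp w) β) ^ 2 ≤ 2 * (0.16 * l2 h) ^ 2 := by
    refine le_of_mul_le_mul_left ?_ (pow_pos hc 2)
    linarith
  refine le_of_sq_le_sq ?_ (by positivity)
  -- `2 * 0.16 ^ 2 = 0.0512 ≤ 0.0529 = 0.23 ^ 2`.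
  nlinarith [sq_nonneg (l2 h)]

/-- Geometric decay of the missed part of the signal along the iterations. -/
theorem IsRun.l2_missed_le {X : Matrix (Fin n) (Fin p) ℝ} {s : ℕ} {δ M c : ℝ}
    (hn : 0 < n) (hX : RIP X (3 * s) δ) (hδ : δ ≤ 0.16 * c) (hδ' : δ ≤ 0.005)
    {β u : Fin p → ℝ} {ξ : Fin n → ℝ}
    (hs : (supp β).card = s) (hu : supp u ⊆ supp β)
    (hnormal : ∀ j ∈ supp β, (Xᵀ *ᵥ (ξ - X *ᵥ u)) j = 0) (hM : 0 ≤ M)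
    (hN : ∀ i, |gradStep X ξ u i| ≤ M) (hβ : ∀ i ∈ supp β, c * |β i| ≤ |β i| - 2 * M)
    {b : ℕ → Fin p → ℝ} {S : ℕ → Finset (Fin p)} (hrun : IsRun X (X *ᵥ β + ξ) s b S)
    (hb : (supp (b 0)).card ≤ s) (t : ℕ) :
    (S (t + 1)).card ≤ s ∧
      l2 (res (supp β \ S (t + 1)) β) ≤ (1 / 2) ^ (t + 1) * l2 (b 0 - β - u) := by
  have hc : 0 < c := by linarith [hX.1]
  have hβ' : ∀ i ∈ supp β, 2 * M ≤ |β i| := fun i hi => by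
    linarith [hβ i hi, mul_nonneg hc.le (abs_nonneg (β i))]
  have hstep : ∀ t, (supp (b t)).card ≤ s → (S (t + 1)).card ≤ s ∧
      (supp (b (t + 1))).card ≤ s ∧
      l2 (res (supp β \ S (t + 1)) β) ≤ 0.23 * l2 (b t - β - u) ∧
      l2 (b (t + 1) - β - u) ≤ 1 / 2 * l2 (b t - β - u) := by
    intro t ht
    obtain ⟨w, hw, hSw, hls⟩ := hrun.step t
    have hScard : (S (t + 1)).card ≤ s := hSw ▸ hw.card_supp_le
    have h1 := hw.l2_missed_le hn hX hδ hs ht hu hN hβ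
    rw [← hSw] at h1
    have h2 := hls.l2_sub_oracle_le hn (hX.mono (by omega)) hs hScard hu hnormal hM hN hβ'
    refine ⟨hScard, (Finset.card_le_card hls.1).trans hScard, h1, ?_⟩
    -- The contraction factor is `2 * 0.23 / 0.995 < 1 / 2`.
    have h3 := mul_nonneg (sub_nonneg.2 hδ') (l2_nonneg (b (t + 1) - β - u))
    nlinarith [l2_nonneg (b t - β - u)]
  have hind : ∀ t, (supp (b t)).card ≤ s ∧
      l2 (b t - β - u) ≤ (1 / 2) ^ t * l2 (b 0 - β - u) := by
    intro t
    induction t with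
    | zero => exact ⟨hb, by simp⟩
    | succ t ih =>
      obtain ⟨-, h1, -, h2⟩ := hstep t ih.1
      exact ⟨h1, by rw [pow_succ]; linarith [ih.2]⟩
  obtain ⟨h1, -, h2, -⟩ := hstep t (hind t).1
  refine ⟨h1, ?_⟩
  rw [pow_succ]
  linarith [(hind t).2, l2_nonneg (b t - β - u)]

/-- A single missed coordinate already contributes `lam` to the norm. -/
theorem supp_eq_of_l2_missed_lt {β : Fin p → ℝ} {S : Finset (Fin p)} {lam : ℝ}
    (hlam : ∀ i ∈ supp β, lam ≤ |β i|) (hS : S.card ≤ (supp β).card)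
    (h : l2 (res (supp β \ S) β) < lam) : S = supp β := by
  refine (Finset.eq_of_subset_of_card_le (fun i hi => ?_) hS).symm
  by_contra hiS
  have h1 : |β i| ≤ l2 (res (supp β \ S) β) := by
    simpa [res, hi, hiS] using abs_apply_le_l2 (res (supp β \ S) β) i
  linarith [hlam i hi]

/-! ### Tail bounds for the oracle noise. -/

/-- Every coordinate of the oracle noise is a linear functional of the noise with a small
coefficient vector. -/
theorem RIP.exists_gradStep_eq_dotProduct {X : Matrix (Fin n) (Fin p) ℝ} {k : ℕ} {δ : ℝ}
    (hX : RIP X k δ) (hn : 0 < n) (hcol : ∀ j, l2 (fun i => X i j) = Real.sqrt n)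
    {S : Finset (Fin p)} (hS : S.card ≤ k) (j : Fin p) :
    ∃ a : Fin n → ℝ, a ⬝ᵥ a ≤ 1 / ((1 - δ) * n) ∧
      ∀ (ξ : Fin n → ℝ) (u : Fin p → ℝ), supp u ⊆ S →
        (∀ i ∈ S, (Xᵀ *ᵥ (ξ - X *ᵥ u)) i = 0) → gradStep X ξ u j = a ⬝ᵥ ξ := by
  have hn' : (0 : ℝ) < n := by exact_mod_cast hn
  have hδ : 0 < 1 - δ := by linarith [hX.2.1]
  have horth : ∀ (z : Fin p → ℝ) (r : Fin n → ℝ), supp z ⊆ S → (∀ i ∈ S, (Xᵀ *ᵥ r) i = 0) →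
      X *ᵥ z ⬝ᵥ r = 0 := fun z r hz hr => by
    rw [mulVec_dotProduct, dotProduct_of_supp_subset hz]
    exact Finset.sum_eq_zero fun i hi => by rw [hr i hi, mul_zero]
  by_cases hj : j ∈ S
  -- Here `z` is column `j` of the inverse Gram matrix on `S` and `a = X *ᵥ z`. Then `a ⬝ᵥ a = z j`,
  -- and RIP gives `(1 - δ) * n * z j ^ 2 ≤ z j`.
  · obtain ⟨z, hz, hzj⟩ := hX.exists_gram_eq hn hS (Pi.single j 1)
    have heval : ∀ u : Fin p → ℝ, supp u ⊆ S → X *ᵥ u ⬝ᵥ X *ᵥ z = u j := fun u hu => by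
      rw [mulVec_dotProduct, dotProduct_of_supp_subset hu]
      rw [Finset.sum_congr rfl fun i hi => by rw [hzj i hi]]
      simp [Pi.single_apply, hj]
    refine ⟨X *ᵥ z, ?_, fun ξ u hu hnormal => ?_⟩
    · have h1 := (hX.2.2 z ((Finset.card_le_card hz).trans hS)).1
      rw [l2_sq (X *ᵥ z), heval z hz] at h1
      rw [heval z hz]
      have h2 : z j ^ 2 ≤ l2 z ^ 2 := by
        rw [← sq_abs]
        exact pow_le_pow_left₀ (abs_nonneg _) (abs_apply_le_l2 z j) 2
      rw [le_div_iff₀ (by positivity)]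
      have h3 : (1 - δ) * n * z j ^ 2 ≤ z j := by
        refine le_trans ?_ h1
        rw [mul_assoc]
        gcongr
      by_contra h4
      push Not at h4
      have h5 : 0 < z j := (le_trans (by positivity) h3).lt_of_ne' fun h0 => by
        rw [h0] at h4; linarith
      linarith [mul_lt_mul_of_pos_left h4 h5, sq (z j), mul_comm (z j) (z j * ((1 - δ) * n))]
    · have h1 := horth z (ξ - X *ᵥ u) hz hnormal
      rw [dotProduct_sub, dotProduct_comm (X *ᵥ z) (X *ᵥ u), heval u hu] at h1
      rw [gradStep, Pi.add_apply, Pi.smul_apply, hnormal j hj]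
      simp only [smul_zero, add_zero]
      linarith
  -- Off `S`, `a = r / n` with `r` the residual of column `j` projected on the columns in `S`; by
  -- Pythagoras its squared norm is at most `n`.
  · obtain ⟨z, hz, hzj⟩ := hX.exists_gram_eq hn hS (Xᵀ *ᵥ X.col j)
    set r := X.col j - X *ᵥ z with hr
    have hr0 : ∀ i ∈ S, (Xᵀ *ᵥ r) i = 0 := fun i hi => by
      rw [hr, mulVec_sub, Pi.sub_apply, hzj i hi, sub_self]
    refine ⟨(1 / (n : ℝ)) • r, ?_, fun ξ u hu hnormal => ?_⟩
    · have h1 := horth z r hz hr0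
      have h2 : X.col j ⬝ᵥ X.col j = n := by
        have h3 : l2 (X.col j) = Real.sqrt n := hcol j
        rw [← l2_sq, h3, Real.sq_sqrt hn'.le]
      have h4 : X.col j = r + X *ᵥ z := by rw [hr]; abel
      have h5 : r ⬝ᵥ r ≤ n := by
        rw [h4] at h2
        simp only [add_dotProduct, dotProduct_add] at h2
        rw [dotProduct_comm r (X *ᵥ z), h1, ← l2_sq (X *ᵥ z)] at h2
        nlinarith [sq_nonneg (l2 (X *ᵥ z))]
      rw [smul_dotProduct, dotProduct_smul, smul_eq_mul, smul_eq_mul]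
      calc 1 / (n : ℝ) * (1 / n * (r ⬝ᵥ r)) ≤ 1 / (n : ℝ) * (1 / n * n) := by gcongr
        _ = 1 / n := by field_simp
        _ ≤ 1 / ((1 - δ) * n) := by
          refine one_div_le_one_div_of_le (by positivity) ?_
          nlinarith [hX.1]
    · have h1 := horth z (ξ - X *ᵥ u) hz hnormal
      have h2 := horth u r hu hr0
      have h3 : (Xᵀ *ᵥ (ξ - X *ᵥ u)) j = X.col j ⬝ᵥ (ξ - X *ᵥ u) := rfl
      have h4 : r ⬝ᵥ ξ = X.col j ⬝ᵥ (ξ - X *ᵥ u) := by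
        have h5 : r ⬝ᵥ (ξ - X *ᵥ u) = X.col j ⬝ᵥ (ξ - X *ᵥ u) := by
          conv_lhs => rw [hr, sub_dotProduct, h1, sub_zero]
        rw [dotProduct_sub, dotProduct_comm r (X *ᵥ u), h2, sub_zero] at h5
        exact h5
      rw [gradStep, Pi.add_apply, Pi.smul_apply, h3, supp_subset_iff.1 hu j hj, smul_dotProduct, h4,
        zero_add]

theorem IsNoise.measureReal_abs_dotProduct_le {Ω : Type*} [MeasurableSpace Ω] {μ : Measure Ω}
    [IsProbabilityMeasure μ] {ξ : Fin n → Ω → ℝ} {σ : ℝ} (hξ : IsNoise μ ξ σ) (a : Fin n → ℝ)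
    {v M : ℝ} (hM : 0 ≤ M) (hv : σ ^ 2 * (a ⬝ᵥ a) ≤ v) :
    μ.real {ω | M ≤ |a ⬝ᵥ fun i => ξ i ω|} ≤ 2 * Real.exp (-M ^ 2 / (2 * v)) := by
  have hv0 : 0 ≤ v := le_trans (by rw [← l2_sq]; positivity) hv
  have hsum : HasSubgaussianMGF (fun ω => a ⬝ᵥ fun i => ξ i ω)
      (∑ i, Real.toNNReal (a i ^ 2) * Real.toNNReal (σ ^ 2)) μ :=
    HasSubgaussianMGF.sum_of_iIndepFun (X := fun i ω => a i * ξ i ω) (s := Finset.univ)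
      (hξ.indep.comp (fun i x => a i * x) fun i => measurable_const_mul _)
      fun i _ => by
        convert (hξ.subgaussian i).const_mul (a i) using 2
        exact congrArg (· * _) (Real.toNNReal_of_nonneg (sq_nonneg _))
  have hle : HasSubgaussianMGF (fun ω => a ⬝ᵥ fun i => ξ i ω) (Real.toNNReal v) μ := by
    refine ⟨hsum.integrable_exp_mul, fun t => (hsum.mgf_le t).trans ?_⟩
    rw [Real.coe_toNNReal v hv0]
    gcongr
    push_cast
    simp only [Real.coe_toNNReal _ (sq_nonneg _)]
    rw [← Finset.sum_mul]
    refine le_trans (le_of_eq ?_) hv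
    rw [mul_comm]
    congr 1
    exact Finset.sum_congr rfl fun i _ => sq (a i)
  have h1 := hle.measure_ge_le hM
  have h2 := hle.neg.measure_ge_le hM
  rw [Real.coe_toNNReal v hv0] at h1 h2
  have hsub : {ω | M ≤ |a ⬝ᵥ fun i => ξ i ω|} ⊆ {ω | M ≤ a ⬝ᵥ fun i => ξ i ω} ∪
      {ω | M ≤ (-fun ω => a ⬝ᵥ fun i => ξ i ω) ω} := fun ω hω => by
    simpa [le_abs] using hω
  have h3 := (measureReal_mono (μ := μ) hsub).trans (measureReal_union_le _ _)
  linarith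

/-- This is `δ ≤ 0.16 * c` for `c = ε / 2 / (1 + ε)`, cleared of denominators. The bound `ε ^ 2`
serves for `ε ≤ 0.07`, the bound `0.005` beyond. -/
theorem mul_one_add_le_of_lt_min {ε δ : ℝ} (hε : 0 < ε) (hδ0 : 0 < δ)
    (hδ : δ < min (ε ^ 2) 0.005) : δ * (1 + ε) ≤ 0.08 * ε := by
  obtain ⟨h1, h2⟩ := lt_min_iff.1 hδ
  rcases le_total ε 0.07 with h | h <;> nlinarith

/-- Union bound for the coordinates of the oracle noise. -/
theorem IsNoise.measureReal_exists_abs_le {Ω : Type*} [MeasurableSpace Ω] {μ : Measure Ω}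
    [IsProbabilityMeasure μ] {ξ : Fin n → Ω → ℝ} {σ : ℝ} (hξ : IsNoise μ ξ σ)
    (a : Fin p → Fin n → ℝ) {v M : ℝ} (hM : 0 ≤ M) (hv : ∀ j, σ ^ 2 * (a j ⬝ᵥ a j) ≤ v) :
    μ.real {ω | ∃ j, M ≤ |a j ⬝ᵥ fun i => ξ i ω|} ≤ p * (2 * Real.exp (-M ^ 2 / (2 * v))) := by
  rw [Set.ofPred_exists]
  calc _ ≤ ∑ j, μ.real {ω | M ≤ |a j ⬝ᵥ fun i => ξ i ω|} := measureReal_iUnion_fintype_le _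
    _ ≤ ∑ _j : Fin p, 2 * Real.exp (-M ^ 2 / (2 * v)) :=
      Finset.sum_le_sum fun j _ => hξ.measureReal_abs_dotProduct_le (a j) hM (hv j)
    _ = _ := by simp

/-- The loss `1 - δ` is absorbed by one factor `1 + ε / 2`. The other leaves `2 * p ^ (-ε / 2)`,
which `hρ` makes at most `η`. -/
theorem card_mul_exp_le {ε δ η σ : ℝ} (hn : 0 < n) (hp : 0 < p) (hσ : 0 < σ) (hε : 0 < ε)
    (hδ0 : 0 < δ) (hδ1 : δ < 1) (hδ : δ * (1 + ε) ≤ 0.08 * ε) (hη : 0 < η)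
    (hρ : 1 / (p : ℝ) ≤ Real.exp (2 / ε * Real.log (η / 2))) :
    p * (2 * Real.exp (-((1 + ε / 2) * (σ * Real.sqrt (2 * Real.log p / n))) ^ 2 /
      (2 * (σ ^ 2 * (1 / ((1 - δ) * n)))))) ≤ η := by
  have hn' : (0 : ℝ) < n := by exact_mod_cast hn
  have hp' : (0 : ℝ) < p := by exact_mod_cast hp
  have hl : 0 ≤ Real.log p := Real.log_natCast_nonneg p
  have h1δ : 0 < 1 - δ := by linarith
  have h1 : -((1 + ε / 2) * (σ * Real.sqrt (2 * Real.log p / n))) ^ 2 /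
      (2 * (σ ^ 2 * (1 / ((1 - δ) * n)))) = -((1 + ε / 2) ^ 2 * (1 - δ) * Real.log p) := by
    rw [mul_pow, mul_pow, Real.sq_sqrt (by positivity)]
    field_simp
  have h2 : (1 + ε / 2) * Real.log p ≤ (1 + ε / 2) ^ 2 * (1 - δ) * Real.log p := by
    gcongr
    nlinarith
  have h3 : -(ε / 2 * Real.log p) ≤ Real.log (η / 2) := by
    have h4 := Real.log_le_log (by positivity) hρ
    rw [Real.log_exp, one_div, Real.log_inv, div_mul_eq_mul_div, le_div_iff₀ hε] at h4
    linarith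
  calc _ = Real.exp (Real.log p) * (2 * Real.exp (-((1 + ε / 2) ^ 2 * (1 - δ) * Real.log p))) := by
        rw [h1, Real.exp_log hp']
    _ ≤ Real.exp (Real.log p) * (2 * Real.exp (-Real.log p + Real.log (η / 2))) := by
        gcongr
        linarith
    _ = η := by
        rw [Real.exp_add, Real.exp_neg, Real.exp_log hp', Real.exp_log (by positivity)]
        field_simp

/-! ### Iteration count and conclusion. -/

/-- Since `1 / 2 ≤ exp (-1 / 2)`, the condition on `t` gives `(1 / 2) ^ t ≤ q⁻¹`, and `q` exceeds
`(C₁ + 1 / 2) * √s`. Positivity of `t` matters because `S 0` is not produced by thresholding. -/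
theorem half_pow_mul_lt {C₁ ε lam H : ℝ} {s t : ℕ} (hC₁ : 0 < C₁) (hε : 0 < ε) (hε1 : ε < 1)
    (hs : 0 < s) (hlam : 0 < lam) (hH : H ≤ (C₁ + 1 / 2) * (Real.sqrt s * lam))
    (ht : 2 * Real.log (((C₁ + 1) / ε) ^ 2 * s) ≤ t) :
    0 < t ∧ (1 / 2) ^ t * H < lam := by
  have hs' : (1 : ℝ) ≤ s := by exact_mod_cast hs
  have hsqrt : Real.sqrt s ≤ s := by
    rw [Real.sqrt_le_left (by positivity)]; nlinarith
  set q := ((C₁ + 1) / ε) ^ 2 * s with hq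
  have h1 : C₁ + 1 ≤ (C₁ + 1) / ε := by
    rw [le_div_iff₀ hε]; nlinarith
  have h2 : (C₁ + 1) * s ≤ q := by
    rw [hq]
    gcongr
    nlinarith
  have hq1 : 1 < q := by nlinarith
  have hq0 : 0 < q := by linarith
  refine ⟨?_, ?_⟩
  · have h3 := Real.log_pos hq1
    have h4 : (0 : ℝ) < t := by linarith
    exact_mod_cast h4
  · have h3 : ((1 : ℝ) / 2) ^ t ≤ q⁻¹ := by
      calc ((1 : ℝ) / 2) ^ t ≤ Real.exp (-(1 / 2)) ^ t := by
            gcongr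
            linarith [Real.add_one_le_exp (-(1 / 2) : ℝ)]
        _ = Real.exp (-(t / 2)) := by rw [← Real.exp_nat_mul]; congr 1; ring
        _ ≤ Real.exp (-Real.log q) := by gcongr; linarith
        _ = q⁻¹ := by rw [Real.exp_neg, Real.exp_log hq0]
    have h5 : (C₁ + 1 / 2) * Real.sqrt s < q := by nlinarith [Real.sqrt_nonneg (s : ℝ)]
    calc ((1 : ℝ) / 2) ^ t * H ≤ (1 / 2) ^ t * ((C₁ + 1 / 2) * (Real.sqrt s * lam)) := by gcongr
      _ ≤ q⁻¹ * ((C₁ + 1 / 2) * (Real.sqrt s * lam)) := by gcongr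
      _ = q⁻¹ * ((C₁ + 1 / 2) * Real.sqrt s) * lam := by ring
      _ < q⁻¹ * q * lam := by gcongr
      _ = lam := by rw [inv_mul_cancel₀ hq0.ne', one_mul]

/-- The oracle estimator and an initial value of the minimax rate are close. -/
theorem IsMinimaxInit.l2_sub_oracle_le {s : ℕ} {σ C₁ lam M : ℝ} {X : Matrix (Fin n) (Fin p) ℝ}
    {β b₀ u : Fin p → ℝ} {ξ : Fin n → ℝ} (h : IsMinimaxInit n s s σ C₁ β b₀) (hC₁ : 0 < C₁)
    (hlam : σ * Real.sqrt (Real.log (p / s) / n) ≤ lam) (hMlam : 2 * M ≤ lam) (hM : 0 ≤ M)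
    (hs : (supp β).card = s) (hu : supp u ⊆ supp β)
    (hnormal : ∀ j ∈ supp β, (Xᵀ *ᵥ (ξ - X *ᵥ u)) j = 0)
    (hN : ∀ i, |gradStep X ξ u i| ≤ M) :
    l2 (b₀ - β - u) ≤ (C₁ + 1 / 2) * (Real.sqrt s * lam) := by
  -- On the true support `u` coincides with the oracle noise.
  have h1 : l2 u ≤ Real.sqrt s * M := by
    refine le_of_sq_le_sq ?_ (by positivity)
    rw [l2_sq, dotProduct_of_supp_subset hu, mul_pow, Real.sq_sqrt (Nat.cast_nonneg s), ← hs,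
      ← nsmul_eq_mul]
    refine Finset.sum_le_card_nsmul _ _ _ fun i hi => ?_
    have h2 : gradStep X ξ u i = u i := by
      rw [gradStep]
      simp [hnormal i hi]
    rw [← sq, ← sq_abs, ← h2]
    exact pow_le_pow_left₀ (abs_nonneg _) (hN i) 2
  have h3 : Real.sqrt (s * Real.log (p / s) / n) = Real.sqrt s * Real.sqrt (Real.log (p / s) / n) := by
    rw [mul_div_assoc, Real.sqrt_mul (Nat.cast_nonneg s)]
  have h4 := h.1
  rw [h3] at h4
  have h5 := l2_sub_le (b₀ - β) u
  have h6 := mul_le_mul_of_nonneg_left hlam (mul_nonneg hC₁.le (Real.sqrt_nonneg (s : ℝ)))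
  have h7 := mul_le_mul_of_nonneg_left hMlam (Real.sqrt_nonneg (s : ℝ))
  linarith

end HTP

open MeasureTheory HTP in
theorem corollary3 (C₁ : ℝ) (hC₁ : 0 < C₁) :
    ∃ C₂ : ℝ, 0 < C₂ ∧ ∀ ε : ℝ, 0 < ε → ε < 1 → ∀ C₀ : ℝ, 0 < C₀ →
    ∀ η : ℝ, 0 < η → ∃ ρ : ℝ, 0 < ρ ∧
    ∀ (n p s smax : ℕ), 0 < n → 0 < s → s ≤ smax → smax ≤ p → (s : ℝ) / p ≤ ρ →
    C₀ * smax * Real.log (p / smax) ≤ n →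
    ∀ (σ lam δ : ℝ), 0 < σ →
    (1 + 3 * ε) * σ * Real.sqrt (2 * Real.log (p / s) / n) ≤ lam →
    (2 + 2 * ε) * σ * Real.sqrt (2 * Real.log p / n) ≤ lam →
    δ < min (ε ^ 2) 0.005 →
    ∀ X : Matrix (Fin n) (Fin p) ℝ, (∀ j, l2 (fun i => X i j) = Real.sqrt n) →
    RIP X (3 * s) δ →
    ∀ (Ω : Type*) [MeasurableSpace Ω] (μ : Measure Ω) [IsProbabilityMeasure μ]
      (ξ : Fin n → Ω → ℝ), IsNoise μ ξ σ →
    ∀ β ∈ signalClass p s lam, (supp β).card = s →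
    ∀ (b : Ω → ℕ → Fin p → ℝ) (S : Ω → ℕ → Finset (Fin p)),
    (∀ ω, IsRun X (X.mulVec β + fun i => ξ i ω) s (b ω) (S ω)) →
    ∀ η₀ : ℝ, μ.real {ω | ¬ IsMinimaxInit n s s σ C₁ β (b ω 0)} ≤ η₀ →
    ∀ t : ℕ, 2 * Real.log ((C₂ / ε) ^ 2 * s) ≤ t →
    μ.real {ω | S ω t ≠ supp β} ≤ η₀ + η := by
  refine ⟨C₁ + 1, by linarith, fun ε hε hε1 C₀ _ η hη =>
    -- The bound `1 / 2` forces `p ≥ 2`, so `log p > 0`; the other term is `(η / 2) ^ (2 / ε)`.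
    ⟨min (1 / 2) (Real.exp (2 / ε * Real.log (η / 2))), by positivity, ?_⟩⟩
  intro n p s smax hn hs hsmax hsmaxp hρ _ σ lam δ hσ hlam₁ hlam₂ hδ X hcol hX Ω _ μ _ ξ hξ β hβ hcard
    b S hrun η₀ hη₀ t ht
  obtain ⟨hρ₁, hρ₂⟩ := le_min_iff.1 hρ
  have hn' : (0 : ℝ) < n := by exact_mod_cast hn
  have hs' : (1 : ℝ) ≤ s := by exact_mod_cast hs
  have hp : 0 < p := by omega
  have hp' : (0 : ℝ) < p := by exact_mod_cast hp
  have hps : 2 * (s : ℝ) ≤ p := by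
    rw [div_le_iff₀ hp'] at hρ₁; linarith
  have hlogp : 0 < Real.log p := Real.log_pos (by linarith)
  have hδ1 : δ < 0.005 := (lt_min_iff.1 hδ).2
  have hδε := mul_one_add_le_of_lt_min hε hX.1 hδ
  set K := σ * Real.sqrt (2 * Real.log p / n) with hK
  have hKpos : 0 < K := by positivity
  -- Strictly between the union-bound level `K` and half the guaranteed signal, `(1 + ε) * K`.
  set M := (1 + ε / 2) * K with hMdef
  have hM : 0 < M := by positivity
  have hlamK : (2 + 2 * ε) * K ≤ lam := by rw [hK, ← mul_assoc]; exact hlam₂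
  have hlam : 0 < lam := lt_of_lt_of_le (by positivity) hlamK
  have hMlam : 2 * M ≤ lam := by rw [hMdef]; nlinarith
  have hrate : σ * Real.sqrt (Real.log (p / s) / n) ≤ lam := by
    have hlog : 0 ≤ Real.log ((p : ℝ) / s) :=
      Real.log_nonneg (by rw [le_div_iff₀ (by linarith)]; linarith)
    refine le_trans ?_ hlam₁
    gcongr
    · nlinarith
    · linarith
  -- The relative margin `1 - (2 + ε) / (2 + 2 * ε)` of the signal over `2 * M`.
  set c := ε / 2 / (1 + ε) with hc
  have hδc : δ ≤ 0.16 * c := by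
    rw [hc, ← mul_div_assoc, le_div_iff₀ (by linarith)]
    linarith
  have hβc : ∀ i ∈ supp β, c * |β i| ≤ |β i| - 2 * M := by
    intro i hi
    have h1 := hβ.2 i hi
    have h2 : |β i| - c * |β i| = (1 + ε / 2) / (1 + ε) * |β i| := by
      rw [hc]; field_simp; ring
    have h3 : (1 + ε / 2) / (1 + ε) * ((2 + 2 * ε) * K) = 2 * M := by
      rw [hMdef]; field_simp
    have h4 : (1 + ε / 2) / (1 + ε) * ((2 + 2 * ε) * K) ≤ (1 + ε / 2) / (1 + ε) * |β i| := by
      gcongr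
      exact hlamK.trans h1
    linarith
  have hsupp3 : (supp β).card ≤ 3 * s := by omega
  choose a ha hagrad using fun j =>
    hX.exists_gradStep_eq_dotProduct hn hcol hsupp3 j
  have hbad := (hξ.measureReal_exists_abs_le a hM.le
    fun j => mul_le_mul_of_nonneg_left (ha j) (sq_nonneg σ)).trans
    (card_mul_exp_le hn hp hσ hε hX.1 hX.2.1 hδε hη (le_trans (by gcongr) hρ₂))
  have hsub : {ω | S ω t ≠ supp β} ⊆ {ω | ¬ IsMinimaxInit n s s σ C₁ β (b ω 0)} ∪
      {ω | ∃ j, M ≤ |a j ⬝ᵥ fun i => ξ i ω|} := by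
    intro ω hω
    by_contra hgood
    simp only [Set.mem_union, Set.mem_ofPred_eq, not_or, not_not, not_exists, not_le] at hgood
    obtain ⟨hinit, hsmall⟩ := hgood
    obtain ⟨u, hu, hgram⟩ := hX.exists_gram_eq hn hsupp3 (X.transpose.mulVec fun i => ξ i ω)
    have hnormal : ∀ j ∈ supp β,
        (X.transpose.mulVec ((fun i => ξ i ω) - X.mulVec u)) j = 0 := fun j hj => by
      rw [Matrix.mulVec_sub, Pi.sub_apply, hgram j hj, sub_self]
    have hN : ∀ i, |gradStep X (fun i => ξ i ω) u i| ≤ M := fun i => by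
      rw [hagrad i _ u hu hnormal]
      exact (hsmall i).le
    have hH := hinit.l2_sub_oracle_le hC₁ hrate hMlam hM.le hcard hu hnormal hN
    obtain ⟨ht0, hlt⟩ := half_pow_mul_lt hC₁ hε hε1 hs hlam hH ht
    obtain ⟨r, rfl⟩ := Nat.exists_eq_succ_of_ne_zero ht0.ne'
    obtain ⟨hcardS, hmiss⟩ := (hrun ω).l2_missed_le hn hX hδc hδ1.le hcard hu hnormal hM.le hN hβc
      hinit.2 r
    exact hω (supp_eq_of_l2_missed_lt hβ.2 (hcardS.trans hcard.ge) (hmiss.trans_lt hlt))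
  have hfin := (measureReal_mono (μ := μ) hsub).trans (measureReal_union_le _ _)
  linarith
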